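/- Let $q\in\mathbb{C}\setminus\{0\}$ not be a root of unity and let $k\ge 1$. Let $U_q=U_q(\mathfrak{gl}(1|1))$ be the unital associative $\mathbb{C}$-algebra with generators $E$, $F$, $\sigma$, $q^h$ ($h\in\mathbb{Z}h_1\oplus\mathbb{Z}h_2$) and relations $q^0=1$, $q^hq^{h'}=q^{h+h'}$, $q^hE=q^{\langle h,\alpha\rangle}Eq^h$, $q^hF=q^{-\langle h,\alpha\rangle}Fq^h$, $EF+FE=\frac{K-K^{-1}}{q-q^{-1}}$ with $K=q^{h_1+h_2}$, $E^2=F^2=0$, $\sigma E=-E\sigma$, $\sigma F=-F\sigma$, $\sigma q^h=q^h\sigma$, $\sigma^2=1$, where $\langle h_i,\varepsilon_j\rangle=\delta_{ij}$ and $\alpha=\varepsilon_1-\varepsilon_2$. Let its coproduct be given by $\Delta(E)=E\otimes K^{-1}+\sigma\otimes E$, $\Delta(F)=F\otimes 1+\sigma K\otimes F$, $\Delta(q^h)=q^h\otimes q^h$, $\Delta(\sigma)=\sigma\otimes\sigma$. Let $V_q=\mathbb{C}x\oplus\mathbb{C}y$ be the $U_q$-module with $Ex=0$, $Ey=x$,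 $Fx=y$, $Fy=0$, $q^hx=q^{\langle h,\varepsilon_1\rangle}x$, $q^hy=q^{\langle h,\varepsilon_2\rangle}y$, $\sigma x=x$, $\sigma y=-y$, and let $U_q$ act on $V_q^{\otimes k}$ through the coproduct. For $s\subseteq\{1,\dots,k-1\}$ put $v_s=E(y\otimes u_1\otimes\cdots\otimes u_{k-1})$, where $u_i=x$ if $i\in s$ and $u_i=y$ if $i\notin s$. Let $P_{k-1}$ be the planar rook monoid, i.e. the monoid under composition of all order-preserving bijections $d:\beta(d)\to\tau(d)$ between subsets of $\{1,\dots,k-1\}$ (order-preserving partial permutations), and let $\mathbb{C}P_{k-1}$ be its monoid algebra, the planar rook algebra. Theorem. There is a unique linear map $\rho:\mathbb{C}P_{k-1}\to\mathrm{End}_{\mathbb{C}}(V_q^{\otimes k})$ such that for all $d\in P_{k-1}$ and $s\subseteq\{1,\dots,k-1\}$ $$\rho(d)v_s=v_{ds},\qquad \rho(d)Fv_s=Fv_{ds}\qquad\text{if } s\subseteq\beta(d),$$ and $\rho(d)v_s=\rho(d)Fv_s=0$ if $s\not\subseteq\beta(d)$, where $ds=\{d(i):i\in s\}$. This $\rho$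 is an isomorphism of algebras from $\mathbb{C}P_{k-1}$ onto the centralizer algebra $\mathrm{End}_{U_q}(V_q^{\otimes k})$; thus $\mathrm{End}_{U_q}(V_q^{\otimes k})=\mathbb{C}P_{k-1}$. -/

import Mathlib

open scoped TensorProduct

/-! ## The planar rook monoid and the planar rook algebra -/

/-- A planar rook diagram on `n` vertices per row, regarded as an order-preserving bijection from
a subset of the bottom row onto a subset of the top row. -/
@[ext]
structure PlanarRook (n : ℕ) where
  /-- the partial bijection from bottom vertices to top vertices -/
  edges : Fin n ≃. Fin n
  /-- no two edges cross -/
  planar : ∀ i j i' j' : Fin n, i' ∈ edges i → j' ∈ edges j → i < j → i' < j'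

namespace PlanarRook

variable {n : ℕ}

/-- The product `d₁ * d₂` places `d₁` above `d₂`, so it is the composite map `d₁ ∘ d₂`. -/
instance : Mul (PlanarRook n) where
  mul d₁ d₂ :=
    { edges := d₂.edges.trans d₁.edges
      planar := by
        intro i j i' j' hi hj hij
        obtain ⟨a, ha, ha'⟩ := (PEquiv.mem_trans _ _ _ _).1 hi
        obtain ⟨b, hb, hb'⟩ := (PEquiv.mem_trans _ _ _ _).1 hj
        exact d₁.planar _ _ _ _ ha' hb' (d₂.planar _ _ _ _ ha hb hij) }

/-- The diagram with `n` vertical edges. -/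
instance : One (PlanarRook n) where
  one :=
    { edges := PEquiv.refl (Fin n)
      planar := by
        intro i j i' j' hi hj hij
        simp only [PEquiv.refl_apply, Option.mem_def, Option.some.injEq] at hi hj
        subst hi hj
        exact hij }

theorem mul_edges (d₁ d₂ : PlanarRook n) : (d₁ * d₂).edges = d₂.edges.trans d₁.edges := rfl

theorem one_edges : (1 : PlanarRook n).edges = PEquiv.refl (Fin n) := rfl

instance : Monoid (PlanarRook n) where
  mul_assoc a b c := PlanarRook.ext (by simp only [mul_edges, PEquiv.trans_assoc])
  one_mul a := PlanarRook.ext (by simp only [mul_edges, one_edges, PEquiv.trans_refl])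
  mul_one a := PlanarRook.ext (by simp only [mul_edges, one_edges, PEquiv.refl_trans])

/-- `β(d)`: the set of bottom vertices of `d` that have an edge, the domain of `d`. -/
def dom (d : PlanarRook n) : Finset (Fin n) :=
  Finset.univ.filter fun i => (d.edges i).isSome

/-- The image `d s` of a set `s` of bottom vertices. -/
def image (d : PlanarRook n) (s : Finset (Fin n)) : Finset (Fin n) :=
  s.biUnion fun i => (d.edges i).toFinset

end PlanarRook

/-- The planar rook algebra `ℂ P_n`. -/
abbrev PlanarRookAlgebra (n : ℕ) : Type := MonoidAlgebra ℂ (PlanarRook n)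

/-! ## The quantum enveloping algebra of `gl(1|1)` -/

namespace QuantumGL11

/-- The generators `E, F, σ, q^h`; the pair `(a, b)` stands for `h = a h₁ + b h₂`, so that
`⟨h, ε₁⟩ = a`, `⟨h, ε₂⟩ = b` and `⟨h, α⟩ = a - b`. -/
inductive Gen : Type
  | E : Gen
  | F : Gen
  | sigma : Gen
  | qpow (h : ℤ × ℤ) : Gen

/-- The free generators. -/
noncomputable abbrev gen (g : Gen) : FreeAlgebra ℂ Gen := FreeAlgebra.ι ℂ g

/-- The defining relations of `U_q(gl(1|1))`; here `K = q^{h₁ + h₂}`. -/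
inductive Rel (q : ℂˣ) : FreeAlgebra ℂ Gen → FreeAlgebra ℂ Gen → Prop
  | qpow_zero : Rel q (gen (.qpow 0)) 1
  | qpow_add (h h' : ℤ × ℤ) :
      Rel q (gen (.qpow h) * gen (.qpow h')) (gen (.qpow (h + h')))
  | qpow_E (h : ℤ × ℤ) :
      Rel q (gen (.qpow h) * gen .E) ((q : ℂ) ^ (h.1 - h.2) • (gen .E * gen (.qpow h)))
  | qpow_F (h : ℤ × ℤ) :
      Rel q (gen (.qpow h) * gen .F) ((q : ℂ) ^ (-(h.1 - h.2)) • (gen .F * gen (.qpow h)))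
  | E_F : Rel q (gen .E * gen .F + gen .F * gen .E)
      (((q : ℂ) - (q : ℂ)⁻¹)⁻¹ • (gen (.qpow (1, 1)) - gen (.qpow (-(1, 1)))))
  | E_E : Rel q (gen .E * gen .E) 0
  | F_F : Rel q (gen .F * gen .F) 0
  | sigma_E : Rel q (gen .sigma * gen .E) (-(gen .E * gen .sigma))
  | sigma_F : Rel q (gen .sigma * gen .F) (-(gen .F * gen .sigma))
  | sigma_qpow (h : ℤ × ℤ) :
      Rel q (gen .sigma * gen (.qpow h)) (gen (.qpow h) * gen .sigma)
  | sigma_sigma : Rel q (gen .sigma * gen .sigma) 1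

/-- The quantum enveloping algebra `U_q(gl(1|1))`. -/
def Uq (q : ℂˣ) : Type := RingQuot (Rel q)

noncomputable instance (q : ℂˣ) : Ring (Uq q) := inferInstanceAs (Ring (RingQuot (Rel q)))

noncomputable instance (q : ℂˣ) : Algebra ℂ (Uq q) :=
  inferInstanceAs (Algebra ℂ (RingQuot (Rel q)))

/-- The quotient map from the free algebra onto `U_q(gl(1|1))`. -/
noncomputable def quot (q : ℂˣ) : FreeAlgebra ℂ Gen →ₐ[ℂ] Uq q := RingQuot.mkAlgHom ℂ (Rel q)

theorem quot_rel {q : ℂˣ} {a b : FreeAlgebra ℂ Gen} (h : Rel q a b) : quot q a = quot q b :=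
  RingQuot.mkAlgHom_rel ℂ h

/-- The class of a generator in `U_q(gl(1|1))`. -/
noncomputable def mk (q : ℂˣ) (g : Gen) : Uq q := quot q (gen g)

/-- The generator `E`. -/
noncomputable def E (q : ℂˣ) : Uq q := mk q .E

/-- The generator `F`. -/
noncomputable def F (q : ℂˣ) : Uq q := mk q .F

/-- The generator `σ`. -/
noncomputable def sigma (q : ℂˣ) : Uq q := mk q .sigma

/-- The generator `q^h`. -/
noncomputable def qpow (q : ℂˣ) (h : ℤ × ℤ) : Uq q := mk q (.qpow h)

/-- `K = q^{h₁ + h₂}`. -/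
noncomputable def K (q : ℂˣ) : Uq q := qpow q (1, 1)

/-- `K⁻¹ = q^{-(h₁ + h₂)}`. -/
noncomputable def Kinv (q : ℂˣ) : Uq q := qpow q (-(1, 1))

section Relations

variable (q : ℂˣ)

theorem qpow_zero : qpow q 0 = 1 := by
  simpa [qpow, mk] using quot_rel (Rel.qpow_zero (q := q))

theorem qpow_mul (h h' : ℤ × ℤ) : qpow q h * qpow q h' = qpow q (h + h') := by
  simpa [qpow, mk] using quot_rel (Rel.qpow_add (q := q) h h')

theorem qpow_mul_E (h : ℤ × ℤ) :
    qpow q h * E q = (q : ℂ) ^ (h.1 - h.2) • (E q * qpow q h) := by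
  simpa only [qpow, E, mk, map_mul, map_smul] using
    quot_rel (Rel.qpow_E (q := q) h)

theorem qpow_mul_F (h : ℤ × ℤ) :
    qpow q h * F q = (q : ℂ) ^ (-(h.1 - h.2)) • (F q * qpow q h) := by
  simpa only [qpow, F, mk, map_mul, map_smul] using
    quot_rel (Rel.qpow_F (q := q) h)

theorem E_mul_F_add : E q * F q + F q * E q =
    ((q : ℂ) - (q : ℂ)⁻¹)⁻¹ • (K q - Kinv q) := by
  simpa only [K, Kinv, qpow, E, F, mk, map_mul, map_smul, map_add, map_sub] using
    quot_rel (Rel.E_F (q := q))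

theorem E_mul_E : E q * E q = 0 := by
  simpa only [E, mk, map_mul, map_zero] using quot_rel (Rel.E_E (q := q))

theorem F_mul_F : F q * F q = 0 := by
  simpa only [F, mk, map_mul, map_zero] using quot_rel (Rel.F_F (q := q))

theorem sigma_mul_E : sigma q * E q = -(E q * sigma q) := by
  simpa only [sigma, E, mk, map_mul, map_neg] using
    quot_rel (Rel.sigma_E (q := q))

theorem sigma_mul_F : sigma q * F q = -(F q * sigma q) := by
  simpa only [sigma, F, mk, map_mul, map_neg] using
    quot_rel (Rel.sigma_F (q := q))

theorem sigma_mul_qpow (h : ℤ × ℤ) : sigma q * qpow q h = qpow q h * sigma q := by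
  simpa only [sigma, qpow, mk, map_mul] using
    quot_rel (Rel.sigma_qpow (q := q) h)

theorem sigma_mul_sigma : sigma q * sigma q = 1 := by
  simpa only [sigma, mk, map_mul, map_one] using
    quot_rel (Rel.sigma_sigma (q := q))

theorem K_mul_E : K q * E q = E q * K q := by
  simpa [K] using qpow_mul_E q (1, 1)

theorem Kinv_mul_E : Kinv q * E q = E q * Kinv q := by
  simpa [Kinv] using qpow_mul_E q (-(1, 1))

theorem K_mul_F : K q * F q = F q * K q := by
  simpa [K] using qpow_mul_F q (1, 1)

theorem Kinv_mul_F : Kinv q * F q = F q * Kinv q := by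
  simpa [Kinv] using qpow_mul_F q (-(1, 1))

end Relations

section Lift

variable {q : ℂˣ} {A : Type*} [Ring A] [Algebra ℂ A]

/-- The elements `e, f, s, t h` of `A` satisfy the defining relations. -/
structure Relations (q : ℂˣ) (e f s : A) (t : ℤ × ℤ → A) : Prop where
  qpow_zero : t 0 = 1
  qpow_add : ∀ h h', t h * t h' = t (h + h')
  qpow_E : ∀ h : ℤ × ℤ, t h * e = (q : ℂ) ^ (h.1 - h.2) • (e * t h)
  qpow_F : ∀ h : ℤ × ℤ, t h * f = (q : ℂ) ^ (-(h.1 - h.2)) • (f * t h)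
  E_F : e * f + f * e = ((q : ℂ) - (q : ℂ)⁻¹)⁻¹ • (t (1, 1) - t (-(1, 1)))
  E_E : e * e = 0
  F_F : f * f = 0
  sigma_E : s * e = -(e * s)
  sigma_F : s * f = -(f * s)
  sigma_qpow : ∀ h, s * t h = t h * s
  sigma_sigma : s * s = 1

/-- The algebra homomorphism out of `U_q(gl(1|1))` given by elements that satisfy the
relations. -/
noncomputable def lift (e f s : A) (t : ℤ × ℤ → A) (H : Relations q e f s t) : Uq q →ₐ[ℂ] A :=
  RingQuot.liftAlgHom ℂ
    ⟨FreeAlgebra.lift ℂ fun g => match g with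
      | .E => e
      | .F => f
      | .sigma => s
      | .qpow h => t h, by
    obtain ⟨h0, hadd, hE, hF, hEF, hEE, hFF, hsE, hsF, hst, hss⟩ := H
    intro a b hab
    cases hab <;>
      simp only [gen, map_mul, map_add, map_sub, map_neg, map_smul, map_one, map_zero,
        FreeAlgebra.lift_ι_apply] <;> solve_by_elim⟩

theorem lift_E (e f s : A) (t : ℤ × ℤ → A) (H : Relations q e f s t) :
    lift e f s t H (E q) = e :=
  (RingQuot.liftAlgHom_mkAlgHom_apply ℂ _ _ _).trans (FreeAlgebra.lift_ι_apply _ _)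

theorem lift_F (e f s : A) (t : ℤ × ℤ → A) (H : Relations q e f s t) :
    lift e f s t H (F q) = f :=
  (RingQuot.liftAlgHom_mkAlgHom_apply ℂ _ _ _).trans (FreeAlgebra.lift_ι_apply _ _)

theorem lift_sigma (e f s : A) (t : ℤ × ℤ → A) (H : Relations q e f s t) :
    lift e f s t H (sigma q) = s :=
  (RingQuot.liftAlgHom_mkAlgHom_apply ℂ _ _ _).trans (FreeAlgebra.lift_ι_apply _ _)

theorem lift_qpow (e f s : A) (t : ℤ × ℤ → A) (H : Relations q e f s t) (h : ℤ × ℤ) :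
    lift e f s t H (qpow q h) = t h :=
  (RingQuot.liftAlgHom_mkAlgHom_apply ℂ _ _ _).trans (FreeAlgebra.lift_ι_apply _ _)

/-- Two algebra homomorphisms out of `U_q(gl(1|1))` agree if they agree on the generators. -/
theorem hom_ext {B : Type*} [Semiring B] [Algebra ℂ B] {φ ψ : Uq q →ₐ[ℂ] B}
    (hE : φ (E q) = ψ (E q)) (hF : φ (F q) = ψ (F q))
    (hs : φ (sigma q) = ψ (sigma q)) (ht : ∀ h, φ (qpow q h) = ψ (qpow q h)) : φ = ψ := by
  apply RingQuot.ringQuot_ext' ℂ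
  apply FreeAlgebra.hom_ext
  funext g
  cases g with
  | E => exact hE
  | F => exact hF
  | sigma => exact hs
  | qpow h => exact ht h

end Lift

theorem comul_relations (q : ℂˣ) : Relations q
    (E q ⊗ₜ[ℂ] Kinv q + sigma q ⊗ₜ[ℂ] E q)
    (F q ⊗ₜ[ℂ] 1 + (sigma q * K q) ⊗ₜ[ℂ] F q)
    (sigma q ⊗ₜ[ℂ] sigma q)
    (fun h => qpow q h ⊗ₜ[ℂ] qpow q h) where
  qpow_zero := by simp only [qpow_zero, Algebra.TensorProduct.one_def]
  qpow_add := fun h h' => by simp only [Algebra.TensorProduct.tmul_mul_tmul, qpow_mul]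
  qpow_E := fun h => by
      simp only [mul_add, add_mul, Algebra.TensorProduct.tmul_mul_tmul, qpow_mul_E, smul_add,
        Kinv, qpow_mul, add_comm, sigma_mul_qpow, TensorProduct.smul_tmul', TensorProduct.tmul_smul]
  qpow_F := fun h => by
      simp only [mul_add, add_mul, Algebra.TensorProduct.tmul_mul_tmul, qpow_mul_F, smul_add,
        K, mul_one, one_mul, TensorProduct.smul_tmul', TensorProduct.tmul_smul]
      rw [mul_assoc, qpow_mul, ← mul_assoc, ← sigma_mul_qpow, mul_assoc, qpow_mul, add_comm h]
  E_F := by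
      have h1 : qpow q ((1, 1) : ℤ × ℤ) = K q := rfl
      have h2 : qpow q (-(1, 1) : ℤ × ℤ) = Kinv q := rfl
      have h3 : sigma q * K q = K q * sigma q := sigma_mul_qpow q _
      have h4 : sigma q * (sigma q * K q) = K q := by
        rw [← mul_assoc, sigma_mul_sigma, one_mul]
      have h5 : sigma q * K q * sigma q = K q := by
        rw [mul_assoc, ← h3, h4]
      have h6 : sigma q * K q * E q = -(E q * (sigma q * K q)) := by
        rw [mul_assoc, K_mul_E, ← mul_assoc, sigma_mul_E, neg_mul, mul_assoc]
      have h7 : E q * F q = ((q : ℂ) - (q : ℂ)⁻¹)⁻¹ • (K q - Kinv q) - F q * E q :=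
        eq_sub_of_add_eq (E_mul_F_add q)
      rw [h1, h2]
      simp only [mul_add, add_mul, Algebra.TensorProduct.tmul_mul_tmul, mul_one, one_mul, h4, h5,
        h6, h7, sigma_mul_F, ← Kinv_mul_F, TensorProduct.neg_tmul, TensorProduct.sub_tmul,
        TensorProduct.tmul_sub, TensorProduct.tmul_smul, ← TensorProduct.smul_tmul', smul_sub]
      abel
  E_E := by
      simp only [mul_add, add_mul, Algebra.TensorProduct.tmul_mul_tmul, E_mul_E, sigma_mul_E,
        Kinv_mul_E, TensorProduct.zero_tmul, TensorProduct.tmul_zero, TensorProduct.neg_tmul]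
      abel
  F_F := by
      have h6 : sigma q * K q * F q = -(F q * (sigma q * K q)) := by
        rw [mul_assoc, K_mul_F, ← mul_assoc, sigma_mul_F, neg_mul, mul_assoc]
      simp only [mul_add, add_mul, Algebra.TensorProduct.tmul_mul_tmul, F_mul_F, h6, mul_one,
        one_mul, TensorProduct.zero_tmul, TensorProduct.tmul_zero, TensorProduct.neg_tmul]
      abel
  sigma_E := by
      have h : sigma q * Kinv q = Kinv q * sigma q := sigma_mul_qpow q _
      simp only [mul_add, add_mul, Algebra.TensorProduct.tmul_mul_tmul, sigma_mul_E, h,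
        TensorProduct.tmul_neg, TensorProduct.neg_tmul, neg_add]
  sigma_F := by
      have h : sigma q * K q * sigma q = sigma q * (sigma q * K q) := by
        rw [mul_assoc, show K q * sigma q = sigma q * K q from (sigma_mul_qpow q _).symm]
      simp only [mul_add, add_mul, Algebra.TensorProduct.tmul_mul_tmul, sigma_mul_F, h,
        mul_one, one_mul, TensorProduct.tmul_neg, TensorProduct.neg_tmul, neg_add]
  sigma_qpow := fun h => by simp only [Algebra.TensorProduct.tmul_mul_tmul, sigma_mul_qpow]
  sigma_sigma := by simp only [Algebra.TensorProduct.tmul_mul_tmul, sigma_mul_sigma,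
      Algebra.TensorProduct.one_def]

/-- The coproduct: `Δ(E) = E ⊗ K⁻¹ + σ ⊗ E`, `Δ(F) = F ⊗ 1 + σ K ⊗ F`, `Δ(σ) = σ ⊗ σ`,
`Δ(q^h) = q^h ⊗ q^h`. -/
noncomputable def comul (q : ℂˣ) : Uq q →ₐ[ℂ] Uq q ⊗[ℂ] Uq q :=
  lift
    (E q ⊗ₜ[ℂ] Kinv q + sigma q ⊗ₜ[ℂ] E q)
    (F q ⊗ₜ[ℂ] 1 + (sigma q * K q) ⊗ₜ[ℂ] F q)
    (sigma q ⊗ₜ[ℂ] sigma q)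
    (fun h => qpow q h ⊗ₜ[ℂ] qpow q h)
    (comul_relations q)

/-- The counit: `E, F ↦ 0` and `σ, q^h ↦ 1`. -/
noncomputable def counit (q : ℂˣ) : Uq q →ₐ[ℂ] ℂ :=
  lift 0 0 1 (fun _ => 1) (by constructor <;> simp)

section Bialgebra

variable (q : ℂˣ)

theorem comul_E : comul q (E q) = E q ⊗ₜ[ℂ] Kinv q + sigma q ⊗ₜ[ℂ] E q := by rw [comul, lift_E]

theorem comul_F : comul q (F q) = F q ⊗ₜ[ℂ] 1 + (sigma q * K q) ⊗ₜ[ℂ] F q := by rw [comul, lift_F]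

theorem comul_sigma : comul q (sigma q) = sigma q ⊗ₜ[ℂ] sigma q := by rw [comul, lift_sigma]

theorem comul_qpow (h : ℤ × ℤ) : comul q (qpow q h) = qpow q h ⊗ₜ[ℂ] qpow q h := by rw [comul, lift_qpow]

theorem comul_K : comul q (K q) = K q ⊗ₜ[ℂ] K q := comul_qpow ..

theorem comul_Kinv : comul q (Kinv q) = Kinv q ⊗ₜ[ℂ] Kinv q := comul_qpow ..

theorem counit_E : counit q (E q) = 0 := by rw [counit, lift_E]

theorem counit_F : counit q (F q) = 0 := by rw [counit, lift_F]

theorem counit_sigma : counit q (sigma q) = 1 := by rw [counit, lift_sigma]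

theorem counit_qpow (h : ℤ × ℤ) : counit q (qpow q h) = 1 := by rw [counit, lift_qpow]

theorem counit_K : counit q (K q) = 1 := counit_qpow ..

theorem counit_Kinv : counit q (Kinv q) = 1 := counit_qpow ..

/-- The coproduct is coassociative and counital, so the bracketing of iterated tensor products of
modules does not matter. -/
noncomputable instance : Bialgebra ℂ (Uq q) :=
  Bialgebra.ofAlgHom (comul q) (counit q)
    (by
      apply hom_ext <;> intros <;>
        simp [comul_E, comul_F, comul_sigma, comul_qpow, comul_K, comul_Kinv,
          TensorProduct.add_tmul, TensorProduct.tmul_add, Algebra.TensorProduct.one_def, add_assoc])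
    (by
      apply hom_ext <;> intros <;>
        simp [comul_E, comul_F, comul_sigma, comul_qpow, counit_E, counit_F, counit_sigma,
          counit_qpow, counit_K])
    (by
      apply hom_ext <;> intros <;>
        simp [comul_E, comul_F, comul_sigma, comul_qpow, counit_E, counit_F, counit_sigma,
          counit_qpow, counit_Kinv])

end Bialgebra

/-! ## The natural module and its tensor powers -/

/-- The underlying space of the natural module `V_q = ℂ x ⊕ ℂ y`. -/
abbrev V : Type := Fin 2 → ℂ

/-- The basis vector `x`. -/
def x : V := ![1, 0]

/-- The basis vector `y`. -/
def y : V := ![0, 1]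

theorem naturalRep_relations (q : ℂˣ) (hq : (q : ℂ) ^ 2 ≠ 1) :
    Relations q (!![0, 1; 0, 0] : Matrix (Fin 2) (Fin 2) ℂ) !![0, 0; 1, 0] !![1, 0; 0, -1]
      (fun h => !![(q : ℂ) ^ h.1, 0; 0, (q : ℂ) ^ h.2]) where
  qpow_zero := by simp [Matrix.one_fin_two]
  qpow_add := fun h h' => by simp [zpow_add₀ q.ne_zero]
  qpow_E := fun h => by
      simp [Matrix.smul_of, zpow_sub₀ q.ne_zero, zpow_ne_zero]
  qpow_F := fun h => by
      simp [Matrix.smul_of, zpow_sub₀ q.ne_zero, zpow_ne_zero]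
  E_F := by
      have h : (q : ℂ) - (q : ℂ)⁻¹ ≠ 0 := by
        intro h
        apply hq
        have := congrArg (fun z => z * (q : ℂ)) h
        simp only [sub_mul, inv_mul_cancel₀ q.ne_zero, zero_mul] at this
        linear_combination this
      ext i j
      fin_cases i <;> fin_cases j <;> simp [inv_mul_cancel₀ h]
  E_E := by ext i j; fin_cases i <;> fin_cases j <;> simp
  F_F := by ext i j; fin_cases i <;> fin_cases j <;> simp
  sigma_E := by simp
  sigma_F := by simp
  sigma_qpow := fun h => by simp
  sigma_sigma := by simp [Matrix.one_fin_two]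

/-- The action of `U_q(gl(1|1))` on `V_q`, by matrices in the basis `x, y`: `E y = x`, `F x = y`,
`E x = 0 = F y`, `σ x = x`, `σ y = -y`, `q^h x = q^⟨h, ε₁⟩ x`, `q^h y = q^⟨h, ε₂⟩ y`. -/
noncomputable def naturalRep (q : ℂˣ) (hq : (q : ℂ) ^ 2 ≠ 1) : Uq q →ₐ[ℂ] Module.End ℂ V :=
  (Matrix.toLinAlgEquiv' : Matrix (Fin 2) (Fin 2) ℂ ≃ₐ[ℂ] Module.End ℂ V).toAlgHom.comp <|
    lift !![0, 1; 0, 0] !![0, 0; 1, 0] !![1, 0; 0, -1]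
      (fun h => !![(q : ℂ) ^ h.1, 0; 0, (q : ℂ) ^ h.2])
      (naturalRep_relations q hq)

/-- The identification `V ⊗ V^{⊗k} = V^{⊗(k+1)}`. -/
noncomputable def consEquiv (k : ℕ) : V ⊗[ℂ] (⨂[ℂ]^k V) ≃ₗ[ℂ] ⨂[ℂ]^(k + 1) V :=
  (TensorProduct.congr (PiTensorProduct.subsingletonEquiv (0 : Fin 1)).symm
    (LinearEquiv.refl ℂ (⨂[ℂ]^k V))).trans <|
    TensorPower.mulEquiv.trans (TensorPower.cast ℂ V (Nat.add_comm 1 k))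

theorem consEquiv_tmul_tprod (k : ℕ) (w : V) (f : Fin k → V) :
    consEquiv k (w ⊗ₜ PiTensorProduct.tprod ℂ f) =
      PiTensorProduct.tprod ℂ (Fin.cons w f : Fin (k + 1) → V) := by
  simp only [consEquiv, LinearEquiv.trans_apply, TensorProduct.congr_tmul,
    LinearEquiv.refl_apply, PiTensorProduct.subsingletonEquiv_symm_apply', TensorPower.mulEquiv,
    PiTensorProduct.tmulEquiv_apply, PiTensorProduct.reindex_tprod, TensorPower.cast_tprod]
  congr 1
  funext i
  refine Fin.cases ?_ (fun j => ?_) i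
  · have h : finSumFinEquiv.symm (Fin.cast (Nat.add_comm 1 k).symm 0) =
        (Sum.inl 0 : Fin 1 ⊕ Fin k) := by
      rw [Equiv.symm_apply_eq]
      ext
      simp
    exact congrArg (Sum.elim (fun _ => w) f) h
  · have h : finSumFinEquiv.symm (Fin.cast (Nat.add_comm 1 k).symm j.succ) =
        (Sum.inr j : Fin 1 ⊕ Fin k) := by
      rw [Equiv.symm_apply_eq]
      ext
      simp [Nat.add_comm]
    exact congrArg (Sum.elim (fun _ => w) f) h

/-- The action of `U_q(gl(1|1))` on `V_q^{⊗k}`: on `V_q^{⊗0} = ℂ` through the counit, and on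
`V_q^{⊗(k+1)} = V_q ⊗ V_q^{⊗k}` through the coproduct. -/
noncomputable def tensorRep (q : ℂˣ) (hq : (q : ℂ) ^ 2 ≠ 1) :
    (k : ℕ) → Uq q →ₐ[ℂ] Module.End ℂ (⨂[ℂ]^k V)
  | 0 => (Algebra.ofId ℂ (Module.End ℂ (⨂[ℂ]^0 V))).comp (counit q)
  | k + 1 =>
    ((consEquiv k).conjAlgEquiv ℂ).toAlgHom.comp <|
      (Module.endTensorEndAlgHom (R := ℂ) (S := ℂ) (A := ℂ) (M := V) (N := ⨂[ℂ]^k V)).comp <|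
        (Algebra.TensorProduct.map (naturalRep q hq) (tensorRep q hq k)).comp (comul q)

/-- The centralizer algebra `End_{U_q}(V_q^{⊗k})`. -/
noncomputable def tensorCentralizer (q : ℂˣ) (hq : (q : ℂ) ^ 2 ≠ 1) (k : ℕ) :
    Subalgebra ℂ (Module.End ℂ (⨂[ℂ]^k V)) :=
  Subalgebra.centralizer ℂ (Set.range (tensorRep q hq k))

/-- The factors of `u_s = u_1 ⊗ ⋯ ⊗ u_n`: `u_i = x` if `i ∈ s`, and `u_i = y` otherwise. -/
def u {n : ℕ} (s : Finset (Fin n)) : Fin n → V := fun i => if i ∈ s then x else y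

/-- The vector `v_s = E (y ⊗ u_s)` of `V_q^{⊗(n+1)}`. -/
noncomputable def v (q : ℂˣ) (hq : (q : ℂ) ^ 2 ≠ 1) {n : ℕ} (s : Finset (Fin n)) :
    ⨂[ℂ]^(n + 1) V :=
  tensorRep q hq (n + 1) (E q)
    (PiTensorProduct.tprod ℂ (Fin.cons y (u s) : Fin (n + 1) → V))

/-- The linear map `ρ` gives the diagram action: `d v_s = v_{d s}` and `d (F v_s) = F v_{d s}` if
`s` is contained in the domain of the diagram `d`, and `d v_s = 0 = d (F v_s)` otherwise. -/
def IsDiagramAction (q : ℂˣ) (hq : (q : ℂ) ^ 2 ≠ 1) {n : ℕ}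
    (ρ : PlanarRookAlgebra n →ₗ[ℂ] Module.End ℂ (⨂[ℂ]^(n + 1) V)) : Prop :=
  ∀ (d : PlanarRook n) (s : Finset (Fin n)),
    ρ (MonoidAlgebra.of ℂ (PlanarRook n) d) (v q hq s) =
        (if s ⊆ d.dom then v q hq (d.image s) else 0) ∧
    ρ (MonoidAlgebra.of ℂ (PlanarRook n) d) (tensorRep q hq (n + 1) (F q) (v q hq s)) =
        (if s ⊆ d.dom then tensorRep q hq (n + 1) (F q) (v q hq (d.image s)) else 0)

end QuantumGL11

/-! Put `n = k - 1`. On `V_q^{⊗k}` the element `K` acts by `q ^ k`, so `E F + F E` acts by the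
scalar `[k]_q`, which is nonzero because `q` is not a root of unity. The vectors `v_s` are killed by
`E`, and `E F v_s = [k]_q v_s`. They are independent, since the part of `v_s` with `x` in the first
factor is `q ^ (-n)` times `x ⊗ u_s`. Applying `E` to a linear relation isolates the coefficients of
the `F v_s`, so all `v_s` and `F v_s` together are independent; there are `2 * 2 ^ n` of them, hence
they form a basis (`basisVFV`).

An endomorphism `T` that commutes with `U_q` preserves the kernel of `E`, which is the span of the
`v_s`. It also preserves the eigenspaces of `q^{h₁}`, which separate the `v_s` by `|s|`, and it is
determined on `F v_s` by its value on `v_s`. The centralizer is therefore spanned by the matrix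
units `unitEnd s t` with `|s| = |t|` (`tensorCentralizer_apply_v`,
`extendEnd_mem_tensorCentralizer`).

A diagram `d` acts as the sum of the units `r ↦ d r` over `r ⊆ β(d)`, with leading term `β(d) ↦
τ(d)`. Planar diagrams correspond to pairs of subsets of equal size, so passing from diagrams to
units is unitriangular for inclusion of domains. This gives injectivity (`diagramAlgHom_injective`)
and surjectivity (`unitEnd_mem_range`). -/

/-! ### Combinatorics of planar rook diagrams. -/

namespace PlanarRook

variable {n : ℕ}

theorem mem_dom {d : PlanarRook n} {i : Fin n} : i ∈ d.dom ↔ ∃ j, j ∈ d.edges i := by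
  simp [dom, Option.isSome_iff_exists]

theorem mem_image {d : PlanarRook n} {s : Finset (Fin n)} {j : Fin n} :
    j ∈ d.image s ↔ ∃ i ∈ s, j ∈ d.edges i := by
  simp [image]

theorem mem_mul_edges {d₁ d₂ : PlanarRook n} {i j : Fin n} :
    j ∈ (d₁ * d₂).edges i ↔ ∃ a, a ∈ d₂.edges i ∧ j ∈ d₁.edges a := by
  rw [mul_edges, PEquiv.mem_trans]

theorem dom_one : (1 : PlanarRook n).dom = Finset.univ := by
  ext i
  simp [mem_dom, one_edges]

theorem image_one (s : Finset (Fin n)) : (1 : PlanarRook n).image s = s := by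
  ext j
  simp [mem_image, one_edges]

/-- Together with `image_mul` this makes the diagram action multiplicative: a product kills `v_s`
exactly when one of the two stages does. -/
theorem subset_dom_mul {d₁ d₂ : PlanarRook n} {s : Finset (Fin n)} :
    s ⊆ (d₁ * d₂).dom ↔ s ⊆ d₂.dom ∧ d₂.image s ⊆ d₁.dom := by
  constructor
  · intro h
    refine ⟨fun i hi => ?_, fun a ha => ?_⟩
    · obtain ⟨j, hj⟩ := mem_dom.1 (h hi)
      obtain ⟨a, ha, -⟩ := mem_mul_edges.1 hj
      exact mem_dom.2 ⟨a, ha⟩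
    · obtain ⟨i, hi, hia⟩ := mem_image.1 ha
      obtain ⟨j, hj⟩ := mem_dom.1 (h hi)
      obtain ⟨b, hb, hbj⟩ := mem_mul_edges.1 hj
      obtain rfl := Option.mem_unique hia hb
      exact mem_dom.2 ⟨j, hbj⟩
  · rintro ⟨h₂, h₁⟩ i hi
    obtain ⟨a, ha⟩ := mem_dom.1 (h₂ hi)
    obtain ⟨j, hj⟩ := mem_dom.1 (h₁ (mem_image.2 ⟨i, hi, ha⟩))
    exact mem_dom.2 ⟨j, mem_mul_edges.2 ⟨a, ha, hj⟩⟩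

theorem image_mul (d₁ d₂ : PlanarRook n) (s : Finset (Fin n)) :
    (d₁ * d₂).image s = d₁.image (d₂.image s) := by
  ext j
  simp only [mem_image, mem_mul_edges]
  constructor
  · rintro ⟨i, hi, a, ha, hj⟩
    exact ⟨a, ⟨i, hi, ha⟩, hj⟩
  · rintro ⟨a, ⟨i, hi, ha⟩, hj⟩
    exact ⟨i, hi, a, ha, hj⟩

theorem exists_strictMonoOn (d : PlanarRook n) :
    ∃ f : Fin n → Fin n, StrictMonoOn f d.dom ∧ ∀ i ∈ d.dom, f i ∈ d.edges i := by
  -- The default value `i` is taken only off the domain, where nothing is claimed.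
  refine ⟨fun i => (d.edges i).getD i, ?_, ?_⟩
  · intro i hi j hj hij
    obtain ⟨a, ha⟩ := mem_dom.1 hi
    obtain ⟨b, hb⟩ := mem_dom.1 hj
    have := d.planar i j a b ha hb hij
    simpa [Option.mem_def.1 ha, Option.mem_def.1 hb] using this
  · intro i hi
    obtain ⟨a, ha⟩ := mem_dom.1 hi
    simp [Option.mem_def.1 ha]

theorem card_image {d : PlanarRook n} {s : Finset (Fin n)} (hs : s ⊆ d.dom) :
    (d.image s).card = s.card := by
  obtain ⟨f, hf, hfd⟩ := d.exists_strictMonoOn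
  have h : d.image s = Finset.image f s := by
    ext j
    rw [mem_image, Finset.mem_image]
    refine exists_congr fun i => and_congr_right fun hi => ?_
    exact ⟨fun hj => Option.mem_unique (hfd i (hs hi)) hj, fun hj => hj ▸ hfd i (hs hi)⟩
  rw [h, Finset.card_image_of_injOn (hf.injOn.mono (by exact_mod_cast hs))]

/-- A planar rook diagram is determined by its domain and its range. -/
theorem ext_of_dom_of_image {d₁ d₂ : PlanarRook n} (h : d₁.dom = d₂.dom)
    (h' : d₁.image d₁.dom = d₂.image d₂.dom) : d₁ = d₂ := by
  -- The `a`-th element of the domain is joined to the `a`-th element of the range, because the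
  -- increasing enumeration of a finite set is unique. This describes the edges by the two sets
  -- alone.
  have key : ∀ d : PlanarRook n, ∀ i j, j ∈ d.edges i ↔ ∃ a : Fin d.dom.card,
      d.dom.orderEmbOfFin rfl a = i ∧
        (d.image d.dom).orderEmbOfFin (card_image subset_rfl) a = j := by
    intro d i j
    obtain ⟨f, hf, hfd⟩ := d.exists_strictMonoOn
    have hmem : ∀ a, d.dom.orderEmbOfFin rfl a ∈ d.dom := Finset.orderEmbOfFin_mem _ _
    have hu := Finset.orderEmbOfFin_unique (s := d.image d.dom) (card_image subset_rfl)
      (f := fun a => f (d.dom.orderEmbOfFin rfl a))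
      (fun a => mem_image.2 ⟨_, hmem a, hfd _ (hmem a)⟩)
      (fun a b hab => hf (hmem a) (hmem b) ((OrderEmbedding.lt_iff_lt _).2 hab))
    constructor
    · intro hj
      have hi : i ∈ d.dom := mem_dom.2 ⟨j, hj⟩
      have : i ∈ Set.range (d.dom.orderEmbOfFin rfl) := by
        rw [Finset.range_orderEmbOfFin]; exact hi
      obtain ⟨a, rfl⟩ := this
      exact ⟨a, rfl, (congrFun hu a).symm.trans (Option.mem_unique (hfd _ hi) hj)⟩
    · rintro ⟨a, rfl, rfl⟩
      rw [← hu]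
      exact hfd _ (hmem a)
  refine PlanarRook.ext (PEquiv.ext fun i => Option.ext fun j => ?_)
  change j ∈ d₁.edges i ↔ j ∈ d₂.edges i
  rw [key, key]
  -- The sets occur in the types of the enumerations, so the equalities are substituted for free
  -- variables.
  have : ∀ (s s' t t' : Finset (Fin n)) (ht : t.card = s.card) (ht' : t'.card = s'.card),
      s = s' → t = t' →
      ((∃ a : Fin s.card, s.orderEmbOfFin rfl a = i ∧ t.orderEmbOfFin ht a = j) ↔
        ∃ a : Fin s'.card, s'.orderEmbOfFin rfl a = i ∧ t'.orderEmbOfFin ht' a = j) := by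
    rintro s _ t _ ht ht' rfl rfl
    rfl
  exact this _ _ _ _ _ _ h h'

/-- The order isomorphism between two finite sets of the same cardinality, as a planar rook
diagram. -/
def ofCardEq {s t : Finset (Fin n)} (h : s.card = t.card) : PlanarRook n :=
  let e : s ≃o t := (s.orderIsoOfFin rfl).symm.trans (t.orderIsoOfFin h.symm)
  { edges :=
      { toFun := fun i => if hi : i ∈ s then some (e ⟨i, hi⟩) else none
        invFun := fun j => if hj : j ∈ t then some (e.symm ⟨j, hj⟩) else none
        inv := by
          intro i j
          simp only [Option.dite_none_right_eq_some, Option.some.injEq]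
          constructor
          · rintro ⟨hj, rfl⟩
            simp
          · rintro ⟨hi, rfl⟩
            simp }
    planar := by
      intro i j i' j' hi hj hij
      change i' ∈ (if hi : i ∈ s then some (e ⟨i, hi⟩ : Fin n) else none) at hi
      change j' ∈ (if hi : j ∈ s then some (e ⟨j, hi⟩ : Fin n) else none) at hj
      simp only [Option.mem_def, Option.dite_none_right_eq_some, Option.some.injEq] at hi hj
      obtain ⟨hi, rfl⟩ := hi
      obtain ⟨hj, rfl⟩ := hj
      exact e.lt_iff_lt.2 hij }

theorem dom_ofCardEq {s t : Finset (Fin n)} (h : s.card = t.card) : (ofCardEq h).dom = s := by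
  ext i
  rw [mem_dom]
  change (∃ j, j ∈ (if hi : i ∈ s then some (_ : Fin n) else none)) ↔ _
  simp only [Option.mem_def, Option.dite_none_right_eq_some]
  exact ⟨fun ⟨_, hi, _⟩ => hi, fun hi => ⟨_, hi, rfl⟩⟩

theorem image_ofCardEq {s t : Finset (Fin n)} (h : s.card = t.card) :
    (ofCardEq h).image s = t := by
  refine Finset.eq_of_subset_of_card_le (fun j hj => ?_) ?_
  · obtain ⟨i, -, hj⟩ := mem_image.1 hj
    change j ∈ (if hi : i ∈ s then some (_ : Fin n) else none) at hj
    simp only [Option.mem_def, Option.dite_none_right_eq_some, Option.some.injEq] at hj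
    obtain ⟨-, rfl⟩ := hj
    exact Subtype.prop _
  · rw [card_image (dom_ofCardEq h).ge, h]

end PlanarRook

/-! ### Action of the generators on tensor powers. -/

namespace QuantumGL11

variable {q : ℂˣ}

/-- Commuting with `T` is stable under sums and products, so induction over the free algebra, which
maps onto `Uq q`, leaves only the generators. -/
theorem mem_tensorCentralizer_of_commute {hq : (q : ℂ) ^ 2 ≠ 1} {k : ℕ}
    {T : Module.End ℂ (⨂[ℂ]^k V)}
    (hE : Commute T (tensorRep q hq k (E q))) (hF : Commute T (tensorRep q hq k (F q)))
    (hs : Commute T (tensorRep q hq k (sigma q)))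
    (ht : ∀ h, Commute T (tensorRep q hq k (qpow q h))) :
    T ∈ tensorCentralizer q hq k := by
  rw [tensorCentralizer, Subalgebra.mem_centralizer_iff]
  rintro _ ⟨a, rfl⟩
  obtain ⟨a, rfl⟩ := RingQuot.mkAlgHom_surjective ℂ (Rel q) a
  change Commute (tensorRep q hq k (quot q a)) T
  induction a using FreeAlgebra.induction with
  | grade0 r => rw [AlgHom.commutes, AlgHom.commutes]; exact Algebra.commutes r T
  | grade1 g =>
    cases g with
    | E => exact hE.symm
    | F => exact hF.symm
    | sigma => exact hs.symm
    | qpow h => exact (ht h).symm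
  | mul a b ha hb => rw [map_mul, map_mul]; exact ha.mul_left hb
  | add a b ha hb => rw [map_add, map_add]; exact ha.add_left hb

section NaturalRep

variable (hq : (q : ℂ) ^ 2 ≠ 1)

theorem naturalRep_E_y : naturalRep q hq (E q) y = x := by
  ext i
  fin_cases i <;> simp [naturalRep, lift_E, x, y, Matrix.toLinAlgEquiv'_apply]

theorem naturalRep_sigma_x : naturalRep q hq (sigma q) x = (1 : ℂ) • x := by
  ext i
  fin_cases i <;> simp [naturalRep, lift_sigma, x, Matrix.toLinAlgEquiv'_apply]

theorem naturalRep_sigma_y : naturalRep q hq (sigma q) y = (-1 : ℂ) • y := by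
  ext i
  fin_cases i <;> simp [naturalRep, lift_sigma, y, Matrix.toLinAlgEquiv'_apply]

theorem naturalRep_qpow_x (h : ℤ × ℤ) : naturalRep q hq (qpow q h) x = (q : ℂ) ^ h.1 • x := by
  ext i
  fin_cases i <;> simp [naturalRep, lift_qpow, x, Matrix.toLinAlgEquiv'_apply]

theorem naturalRep_qpow_y (h : ℤ × ℤ) : naturalRep q hq (qpow q h) y = (q : ℂ) ^ h.2 • y := by
  ext i
  fin_cases i <;> simp [naturalRep, lift_qpow, y, Matrix.toLinAlgEquiv'_apply]

/-- Both `x` and `y` have weight `m` under `m (h₁ + h₂)`; hence `K` is a scalar on every tensor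
power. -/
theorem naturalRep_qpow_diag (m : ℤ) (w : V) :
    naturalRep q hq (qpow q (m, m)) w = (q : ℂ) ^ m • w := by
  ext i
  fin_cases i <;> simp [naturalRep, lift_qpow, Matrix.toLinAlgEquiv'_apply, Matrix.mulVec,
    dotProduct, Fin.sum_univ_two]

end NaturalRep

section TensorRep

variable (hq : (q : ℂ) ^ 2 ≠ 1)

theorem tensorRep_succ_consEquiv (k : ℕ) (a : Uq q) (z : V ⊗[ℂ] (⨂[ℂ]^k V)) :
    tensorRep q hq (k + 1) a (consEquiv k z) =
      consEquiv k (Module.endTensorEndAlgHom (R := ℂ) (S := ℂ) (A := ℂ)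
        (Algebra.TensorProduct.map (naturalRep q hq) (tensorRep q hq k) (comul q a)) z) := by
  simp [tensorRep, LinearEquiv.conjAlgEquiv]

/-- A group-like element acts factor by factor; the counit condition settles the empty tensor power.
-/
theorem tensorRep_tprod_of_comul {g : Uq q} (hg : comul q g = g ⊗ₜ g) (hg' : counit q g = 1)
    {k : ℕ} (f : Fin k → V) :
    tensorRep q hq k g (PiTensorProduct.tprod ℂ f) =
      PiTensorProduct.tprod ℂ fun i => naturalRep q hq g (f i) := by
  induction k with
  | zero =>
    simp only [tensorRep, AlgHom.comp_apply, hg', map_one, Module.End.one_apply]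
    exact congrArg _ (Subsingleton.elim _ _)
  | succ k ih =>
    obtain ⟨w, f, rfl⟩ : ∃ w f', f = Fin.cons w f' := ⟨f 0, Fin.tail f, (Fin.cons_self_tail f).symm⟩
    rw [← consEquiv_tmul_tprod, tensorRep_succ_consEquiv, hg, Algebra.TensorProduct.map_tmul,
      Module.endTensorEndAlgHom_apply, TensorProduct.AlgebraTensorModule.map_tmul, ih,
      consEquiv_tmul_tprod]
    congr 1
    funext i
    refine Fin.cases ?_ (fun j => ?_) i <;> simp

theorem tensorRep_tprod_cons_y_u {g : Uq q} (hg : comul q g = g ⊗ₜ g) (hg' : counit q g = 1)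
    {a b : ℂ} (hx : naturalRep q hq g x = a • x) (hy : naturalRep q hq g y = b • y)
    {n : ℕ} (s : Finset (Fin n)) :
    tensorRep q hq (n + 1) g (PiTensorProduct.tprod ℂ (Fin.cons y (u s) : Fin (n + 1) → V)) =
      (b * (a ^ s.card * b ^ (n - s.card))) •
        PiTensorProduct.tprod ℂ (Fin.cons y (u s) : Fin (n + 1) → V) := by
  rw [tensorRep_tprod_of_comul hq hg hg']
  have : (fun i => naturalRep q hq g ((Fin.cons y (u s) : Fin (n + 1) → V) i)) =
      fun i => (Fin.cons b (fun j => if j ∈ s then a else b) : Fin (n + 1) → ℂ) i •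
        (Fin.cons y (u s) : Fin (n + 1) → V) i := by
    funext i
    refine Fin.cases ?_ (fun j => ?_) i
    · simpa using hy
    · by_cases hj : j ∈ s <;> simp [u, hj, hx, hy]
  rw [this, MultilinearMap.map_smul_univ, Fin.prod_univ_succ]
  congr 2
  simp only [Fin.cons_succ]
  rw [Finset.prod_ite, Finset.prod_const, Finset.prod_const, Finset.filter_mem_eq_inter,
    Finset.univ_inter, Finset.filter_not, Finset.filter_mem_eq_inter, Finset.univ_inter,
    ← Finset.compl_eq_univ_sdiff, Finset.card_compl, Fintype.card_fin]

theorem tensorRep_qpow_diag (k : ℕ) (m : ℤ) :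
    tensorRep q hq k (qpow q (m, m)) = algebraMap ℂ _ (((q : ℂ) ^ m) ^ k) := by
  refine PiTensorProduct.ext (MultilinearMap.ext fun f => ?_)
  rw [LinearMap.compMultilinearMap_apply, LinearMap.compMultilinearMap_apply,
    tensorRep_tprod_of_comul hq (comul_qpow q _) (counit_qpow q _)]
  simp only [naturalRep_qpow_diag]
  rw [MultilinearMap.map_smul_univ, Finset.prod_const, Finset.card_univ, Fintype.card_fin,
    Module.algebraMap_end_apply]

/-- The scalar `[k]_q` by which `E F + F E` acts on `V_q^{⊗k}`. -/
noncomputable def quantumInt (q : ℂˣ) (k : ℕ) : ℂ :=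
  ((q : ℂ) - (q : ℂ)⁻¹)⁻¹ * ((q : ℂ) ^ k - ((q : ℂ)⁻¹) ^ k)

theorem quantumInt_ne_zero (hq' : ∀ m : ℕ, 0 < m → (q : ℂ) ^ m ≠ 1) {k : ℕ} (hk : 0 < k) :
    quantumInt q k ≠ 0 := by
  have key : ∀ m : ℕ, 0 < m → (q : ℂ) ^ m - ((q : ℂ)⁻¹) ^ m ≠ 0 := by
    intro m hm h
    apply hq' (m + m) (by omega)
    have hne : (q : ℂ) ^ m ≠ 0 := pow_ne_zero _ q.ne_zero
    rw [inv_pow, sub_eq_zero] at h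
    rw [pow_add]
    nth_rewrite 1 [h]
    exact inv_mul_cancel₀ hne
  -- The case `m = 1` of `key` is the denominator `q - q⁻¹`.
  exact mul_ne_zero (inv_ne_zero (by simpa using key 1 one_pos)) (key k hk)

theorem tensorRep_E_F_add (k : ℕ) (w : ⨂[ℂ]^k V) :
    tensorRep q hq k (E q) (tensorRep q hq k (F q) w) +
      tensorRep q hq k (F q) (tensorRep q hq k (E q) w) = quantumInt q k • w := by
  have h := congrArg (tensorRep q hq k) (E_mul_F_add q)
  have hK : tensorRep q hq k (K q) = algebraMap ℂ _ (((q : ℂ) ^ (1 : ℤ)) ^ k) :=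
    tensorRep_qpow_diag hq k 1
  have hK' : tensorRep q hq k (Kinv q) = algebraMap ℂ _ (((q : ℂ) ^ (-1 : ℤ)) ^ k) :=
    tensorRep_qpow_diag hq k (-1)
  rw [map_add, map_mul, map_mul, map_smul, map_sub, hK, hK', ← map_sub] at h
  have h' := LinearMap.congr_fun h w
  rw [LinearMap.smul_apply, Module.algebraMap_end_apply, ← mul_smul, zpow_one, zpow_neg_one] at h'
  exact h'

/-! ### The vectors `v_s` and the basis they generate. -/

variable {n : ℕ} (s : Finset (Fin n))

theorem tensorRep_E_v : tensorRep q hq (n + 1) (E q) (v q hq s) = 0 := by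
  rw [v, ← Module.End.mul_apply, ← map_mul, E_mul_E, map_zero, LinearMap.zero_apply]

theorem tensorRep_F_F (w : ⨂[ℂ]^(n + 1) V) :
    tensorRep q hq (n + 1) (F q) (tensorRep q hq (n + 1) (F q) w) = 0 := by
  rw [← Module.End.mul_apply, ← map_mul, F_mul_F, map_zero, LinearMap.zero_apply]

theorem tensorRep_E_F_v : tensorRep q hq (n + 1) (E q) (tensorRep q hq (n + 1) (F q) (v q hq s)) =
    quantumInt q (n + 1) • v q hq s := by
  simpa [tensorRep_E_v] using tensorRep_E_F_add hq (n + 1) (v q hq s)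

/-- Moving `q^h` past `E` costs `q ^ ⟨h, α⟩`; the remaining factor is the weight of `y ⊗ u_s`. The
eigenvalue depends on `s` only through `s.card`. -/
theorem tensorRep_qpow_v (h : ℤ × ℤ) :
    tensorRep q hq (n + 1) (qpow q h) (v q hq s) =
      ((q : ℂ) ^ (h.1 - h.2) * ((q : ℂ) ^ h.2 *
        (((q : ℂ) ^ h.1) ^ s.card * ((q : ℂ) ^ h.2) ^ (n - s.card)))) • v q hq s := by
  rw [v, ← Module.End.mul_apply, ← map_mul, qpow_mul_E, map_smul, LinearMap.smul_apply, map_mul,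
    Module.End.mul_apply, tensorRep_tprod_cons_y_u hq (comul_qpow q h) (counit_qpow q h)
      (naturalRep_qpow_x hq h) (naturalRep_qpow_y hq h), map_smul, ← mul_smul]

theorem tensorRep_sigma_v :
    tensorRep q hq (n + 1) (sigma q) (v q hq s) =
      (-((-1) * (1 ^ s.card * (-1) ^ (n - s.card))) : ℂ) • v q hq s := by
  rw [v, ← Module.End.mul_apply, ← map_mul, sigma_mul_E, map_neg, LinearMap.neg_apply, map_mul,
    Module.End.mul_apply, tensorRep_tprod_cons_y_u hq (comul_sigma q) (counit_sigma q)
      (naturalRep_sigma_x hq) (naturalRep_sigma_y hq), map_smul]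
  exact (neg_smul _ _).symm

/-- The coefficient of `x` in the first tensor factor. -/
noncomputable def firstCoord (n : ℕ) : (⨂[ℂ]^(n + 1) V) →ₗ[ℂ] ⨂[ℂ]^n V :=
  (TensorProduct.lid ℂ _).toLinearMap ∘ₗ
    (LinearMap.proj (0 : Fin 2) : V →ₗ[ℂ] ℂ).rTensor _ ∘ₗ (consEquiv n).symm.toLinearMap

/-- In `Δ(E) = E ⊗ K⁻¹ + σ ⊗ E` the second term keeps `y` in the first factor, so only `E y ⊗ K⁻¹
u_s` is seen. -/
theorem firstCoord_v :
    firstCoord n (v q hq s) = ((q : ℂ) ^ (-1 : ℤ)) ^ n • PiTensorProduct.tprod ℂ (u s) := by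
  have hK' : tensorRep q hq n (Kinv q) = algebraMap ℂ _ (((q : ℂ) ^ (-1 : ℤ)) ^ n) :=
    tensorRep_qpow_diag hq n (-1)
  rw [v, ← consEquiv_tmul_tprod, tensorRep_succ_consEquiv, comul_E, map_add, map_add,
    Algebra.TensorProduct.map_tmul, Algebra.TensorProduct.map_tmul,
    Module.endTensorEndAlgHom_apply, Module.endTensorEndAlgHom_apply, LinearMap.add_apply,
    TensorProduct.AlgebraTensorModule.map_tmul, TensorProduct.AlgebraTensorModule.map_tmul,
    naturalRep_E_y, naturalRep_sigma_y, hK', Module.algebraMap_end_apply]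
  simp [firstCoord, x, y]

theorem linearIndependent_tprod_u :
    LinearIndependent ℂ fun s : Finset (Fin n) => PiTensorProduct.tprod ℂ (u s) := by
  have hinj : Function.Injective
      fun (s : Finset (Fin n)) (i : Fin n) => if i ∈ s then (0 : Fin 2) else 1 := by
    intro s t hst
    ext i
    have := congrFun hst i
    by_cases hs : i ∈ s <;> by_cases ht : i ∈ t <;> simp_all
  have h := (Basis.piTensorProduct fun _ : Fin n =>
    Pi.basisFun ℂ (Fin 2)).linearIndependent.comp _ hinj
  suffices he : (fun s : Finset (Fin n) => PiTensorProduct.tprod ℂ (u s)) =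
      (Basis.piTensorProduct fun _ : Fin n => Pi.basisFun ℂ (Fin 2)) ∘
        fun (s : Finset (Fin n)) (i : Fin n) => if i ∈ s then (0 : Fin 2) else 1 by
    rw [he]
    exact h
  funext s
  rw [Function.comp_apply, Basis.piTensorProduct_apply]
  congr 1
  funext i
  ext j
  by_cases hi : i ∈ s <;> fin_cases j <;> simp [u, hi, x, y]

theorem linearIndependent_v : LinearIndependent ℂ (v q hq : Finset (Fin n) → _) := by
  refine LinearIndependent.of_comp (firstCoord n) ?_
  have h : firstCoord n ∘ (v q hq : Finset (Fin n) → _) = fun s =>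
      (Units.mk0 (((q : ℂ) ^ (-1 : ℤ)) ^ n) (pow_ne_zero _ (zpow_ne_zero _ q.ne_zero))) •
        PiTensorProduct.tprod ℂ (u s) :=
    funext fun s => firstCoord_v hq s
  rw [h]
  exact linearIndependent_tprod_u.units_smul fun _ => _

/-- The family of all `v_s` and all `F v_s`. -/
noncomputable def vFv (q : ℂˣ) (hq : (q : ℂ) ^ 2 ≠ 1) (n : ℕ) :
    Finset (Fin n) ⊕ Finset (Fin n) → ⨂[ℂ]^(n + 1) V :=
  Sum.elim (v q hq) fun s => tensorRep q hq (n + 1) (F q) (v q hq s)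

/-- `E` kills every `v_s` and turns `F v_s` into a nonzero multiple of `v_s`, so the coefficients of
the `F v_s` vanish and independence of the `v_s` finishes. -/
theorem linearIndependent_vFv (hc : quantumInt q (n + 1) ≠ 0) :
    LinearIndependent ℂ (vFv q hq n) := by
  have hv := Fintype.linearIndependent_iff.1 (linearIndependent_v (n := n) hq)
  rw [Fintype.linearIndependent_iff]
  intro g hg
  rw [Fintype.sum_sum_type] at hg
  simp only [vFv, Sum.elim_inl, Sum.elim_inr] at hg
  have h2 : ∀ s, g (Sum.inr s) = 0 := by
    intro s
    have h := congrArg (tensorRep q hq (n + 1) (E q)) hg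
    simp only [map_add, map_sum, map_smul, tensorRep_E_v, smul_zero, Finset.sum_const_zero,
      zero_add, map_zero, tensorRep_E_F_v, ← mul_smul] at h
    exact (mul_eq_zero.1 (hv _ h s)).resolve_right hc
  have h1 : ∀ s, g (Sum.inl s) = 0 := by
    refine hv _ ?_
    simpa [h2] using hg
  exact Sum.rec h1 h2

/-- The basis of `V_q^{⊗(n+1)}` that consists of all `v_s` and all `F v_s`. -/
noncomputable def basisVFV (hc : quantumInt q (n + 1) ≠ 0) :
    Module.Basis (Finset (Fin n) ⊕ Finset (Fin n)) ℂ (⨂[ℂ]^(n + 1) V) :=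
  basisOfLinearIndependentOfCardEqFinrank (linearIndependent_vFv hq hc) (by
    -- Two copies of the `2 ^ n` subsets match the dimension `2 ^ (n + 1)`.
    rw [Module.finrank_eq_card_basis (Basis.piTensorProduct fun _ : Fin (n + 1) =>
      Pi.basisFun ℂ (Fin 2))]
    simp [pow_succ, mul_two])

theorem basisVFV_inl (hc : quantumInt q (n + 1) ≠ 0) :
    basisVFV hq hc (Sum.inl s) = v q hq s := by
  simp [basisVFV, vFv]

theorem basisVFV_inr (hc : quantumInt q (n + 1) ≠ 0) :
    basisVFV hq hc (Sum.inr s) = tensorRep q hq (n + 1) (F q) (v q hq s) := by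
  simp [basisVFV, vFv]

end TensorRep

end QuantumGL11

/-! ### The diagram action and its injectivity. -/

namespace QuantumGL11

variable {q : ℂˣ} (hq : (q : ℂ) ^ 2 ≠ 1) {n : ℕ} (hc : quantumInt q (n + 1) ≠ 0)

theorem end_ext_vFv {M : Type*} [AddCommMonoid M] [Module ℂ M] {S T : (⨂[ℂ]^(n + 1) V) →ₗ[ℂ] M}
    (hc : quantumInt q (n + 1) ≠ 0) (h : ∀ s, S (v q hq s) = T (v q hq s))
    (h' : ∀ s, S (tensorRep q hq (n + 1) (F q) (v q hq s)) =
      T (tensorRep q hq (n + 1) (F q) (v q hq s))) : S = T := by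
  refine (basisVFV hq hc).ext fun i => ?_
  cases i with
  | inl s => simpa only [basisVFV_inl] using h s
  | inr s => simpa only [basisVFV_inr] using h' s

/-- The endomorphism given by `v_s ↦ f s`, `F v_s ↦ F (f s)`. -/
noncomputable def extendEnd (f : Finset (Fin n) → ⨂[ℂ]^(n + 1) V) :
    Module.End ℂ (⨂[ℂ]^(n + 1) V) :=
  (basisVFV hq hc).constr ℂ (Sum.elim f fun s => tensorRep q hq (n + 1) (F q) (f s))

theorem extendEnd_v (f : Finset (Fin n) → ⨂[ℂ]^(n + 1) V) (s : Finset (Fin n)) :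
    extendEnd hq hc f (v q hq s) = f s := by
  rw [extendEnd, ← basisVFV_inl hq s hc, Module.Basis.constr_basis, Sum.elim_inl]

theorem extendEnd_F_v (f : Finset (Fin n) → ⨂[ℂ]^(n + 1) V) (s : Finset (Fin n)) :
    extendEnd hq hc f (tensorRep q hq (n + 1) (F q) (v q hq s)) =
      tensorRep q hq (n + 1) (F q) (f s) := by
  rw [extendEnd, ← basisVFV_inr hq s hc, Module.Basis.constr_basis, Sum.elim_inr]

theorem tensorRep_qpow_F (h : ℤ × ℤ) (w : ⨂[ℂ]^(n + 1) V) :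
    tensorRep q hq (n + 1) (qpow q h) (tensorRep q hq (n + 1) (F q) w) =
      (q : ℂ) ^ (-(h.1 - h.2)) •
        tensorRep q hq (n + 1) (F q) (tensorRep q hq (n + 1) (qpow q h) w) := by
  rw [← Module.End.mul_apply, ← map_mul, qpow_mul_F, map_smul, LinearMap.smul_apply, map_mul,
    Module.End.mul_apply]

theorem tensorRep_sigma_F (w : ⨂[ℂ]^(n + 1) V) :
    tensorRep q hq (n + 1) (sigma q) (tensorRep q hq (n + 1) (F q) w) =
      -tensorRep q hq (n + 1) (F q) (tensorRep q hq (n + 1) (sigma q) w) := by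
  rw [← Module.End.mul_apply, ← map_mul, sigma_mul_F, map_neg, LinearMap.neg_apply, map_mul,
    Module.End.mul_apply]

/-- `extendEnd f` commutes with `U_q(gl(1|1))` if `f s` is zero or some `v_t` with
`|t| = |s|`. -/
theorem extendEnd_mem_tensorCentralizer {f : Finset (Fin n) → ⨂[ℂ]^(n + 1) V}
    (hf : ∀ s, f s = 0 ∨ ∃ t : Finset (Fin n), t.card = s.card ∧ f s = v q hq t) :
    extendEnd hq hc f ∈ tensorCentralizer q hq (n + 1) := by
  -- All that matters about `f s` is that `E` kills it and that `σ` and `q^h` scale it as they scale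
  -- `v_s`; equal cardinality ensures the latter.
  have hE : ∀ s, tensorRep q hq (n + 1) (E q) (f s) = 0 := by
    intro s
    obtain h | ⟨t, -, h⟩ := hf s
    · rw [h, map_zero]
    · rw [h, tensorRep_E_v]
  have hEF : ∀ s, tensorRep q hq (n + 1) (E q) (tensorRep q hq (n + 1) (F q) (f s)) =
      quantumInt q (n + 1) • f s := by
    intro s
    have := tensorRep_E_F_add hq (n + 1) (f s)
    rwa [hE, map_zero, add_zero] at this
  have hsigma : ∀ s, tensorRep q hq (n + 1) (sigma q) (f s) =
      (-((-1) * (1 ^ s.card * (-1) ^ (n - s.card))) : ℂ) • f s := by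
    intro s
    obtain h | ⟨t, ht, h⟩ := hf s
    · rw [h, map_zero, smul_zero]
    · rw [h, tensorRep_sigma_v, ht]
  have hqpow : ∀ (h : ℤ × ℤ) s, tensorRep q hq (n + 1) (qpow q h) (f s) =
      ((q : ℂ) ^ (h.1 - h.2) * ((q : ℂ) ^ h.2 *
        (((q : ℂ) ^ h.1) ^ s.card * ((q : ℂ) ^ h.2) ^ (n - s.card)))) • f s := by
    intro h s
    obtain h | ⟨t, ht, h⟩ := hf s
    · rw [h, map_zero, smul_zero]
    · rw [h, tensorRep_qpow_v, ht]
  refine mem_tensorCentralizer_of_commute ?_ ?_ ?_ fun h => ?_ <;>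
    refine end_ext_vFv hq hc (fun s => ?_) fun s => ?_ <;>
      simp only [Module.End.mul_apply]
  · rw [tensorRep_E_v, map_zero, extendEnd_v, hE]
  · rw [tensorRep_E_F_v, map_smul, extendEnd_v, extendEnd_F_v, hEF]
  · rw [extendEnd_F_v, extendEnd_v]
  · rw [tensorRep_F_F, map_zero, extendEnd_F_v, tensorRep_F_F]
  · rw [tensorRep_sigma_v, map_smul, extendEnd_v, hsigma]
  · rw [tensorRep_sigma_F, tensorRep_sigma_v, map_neg, map_smul, map_smul, extendEnd_F_v,
      tensorRep_sigma_F, hsigma, map_smul]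
  · rw [tensorRep_qpow_v, map_smul, extendEnd_v, hqpow]
  · rw [tensorRep_qpow_F, tensorRep_qpow_v, map_smul, map_smul, map_smul, extendEnd_F_v,
      tensorRep_qpow_F, hqpow, map_smul]

/-- The action of a planar rook diagram: `v_s ↦ v_{d s}` and `F v_s ↦ F v_{d s}` if `s` is
contained in the domain of `d`, and `v_s, F v_s ↦ 0` otherwise. -/
noncomputable def diagramEnd (d : PlanarRook n) : Module.End ℂ (⨂[ℂ]^(n + 1) V) :=
  extendEnd hq hc fun s => if s ⊆ d.dom then v q hq (d.image s) else 0

theorem diagramEnd_v (d : PlanarRook n) (s : Finset (Fin n)) :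
    diagramEnd hq hc d (v q hq s) = if s ⊆ d.dom then v q hq (d.image s) else 0 :=
  extendEnd_v ..

theorem diagramEnd_F_v (d : PlanarRook n) (s : Finset (Fin n)) :
    diagramEnd hq hc d (tensorRep q hq (n + 1) (F q) (v q hq s)) =
      if s ⊆ d.dom then tensorRep q hq (n + 1) (F q) (v q hq (d.image s)) else 0 := by
  rw [diagramEnd, extendEnd_F_v, apply_ite (tensorRep q hq (n + 1) (F q)), map_zero]

/-- The diagram action as a monoid homomorphism. -/
noncomputable def diagramHom : PlanarRook n →* Module.End ℂ (⨂[ℂ]^(n + 1) V) where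
  toFun := diagramEnd hq hc
  map_one' := by
    refine end_ext_vFv hq hc (fun s => ?_) fun s => ?_
    · simp [diagramEnd_v, PlanarRook.dom_one, PlanarRook.image_one]
    · simp [diagramEnd_F_v, PlanarRook.dom_one, PlanarRook.image_one]
  map_mul' d₁ d₂ := by
    refine end_ext_vFv hq hc (fun s => ?_) fun s => ?_
    · simp only [Module.End.mul_apply, diagramEnd_v, PlanarRook.subset_dom_mul,
        PlanarRook.image_mul]
      by_cases h₂ : s ⊆ d₂.dom <;> simp [h₂, diagramEnd_v]
    · simp only [Module.End.mul_apply, diagramEnd_F_v, PlanarRook.subset_dom_mul,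
        PlanarRook.image_mul]
      by_cases h₂ : s ⊆ d₂.dom <;> simp [h₂, diagramEnd_F_v]

/-- The action of the planar rook algebra on `V_q^{⊗(n+1)}`. -/
noncomputable def diagramAlgHom :
    PlanarRookAlgebra n →ₐ[ℂ] Module.End ℂ (⨂[ℂ]^(n + 1) V) :=
  MonoidAlgebra.lift ℂ _ _ (diagramHom hq hc)

theorem diagramAlgHom_of (d : PlanarRook n) :
    diagramAlgHom hq hc (MonoidAlgebra.of ℂ (PlanarRook n) d) = diagramEnd hq hc d :=
  MonoidAlgebra.lift_of _ _

theorem isDiagramAction_diagramAlgHom :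
    IsDiagramAction q hq (diagramAlgHom hq hc).toLinearMap := by
  intro d s
  rw [AlgHom.toLinearMap_apply, diagramAlgHom_of]
  exact ⟨diagramEnd_v .., diagramEnd_F_v ..⟩

theorem IsDiagramAction.eq_diagramAlgHom
    {Ψ : PlanarRookAlgebra n →ₗ[ℂ] Module.End ℂ (⨂[ℂ]^(n + 1) V)}
    (hΨ : IsDiagramAction q hq Ψ) : Ψ = (diagramAlgHom hq hc).toLinearMap := by
  have hρ := isDiagramAction_diagramAlgHom hq hc
  refine MonoidAlgebra.lhom_ext' fun d => LinearMap.ext_ring ?_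
  refine end_ext_vFv hq hc (fun s => ?_) fun s => ?_
  · exact (hΨ d s).1.trans (hρ d s).1.symm
  · exact (hΨ d s).2.trans (hρ d s).2.symm

theorem diagramEnd_mem_tensorCentralizer (d : PlanarRook n) :
    diagramEnd hq hc d ∈ tensorCentralizer q hq (n + 1) := by
  refine extendEnd_mem_tensorCentralizer hq hc fun s => ?_
  by_cases h : s ⊆ d.dom
  · exact Or.inr ⟨d.image s, PlanarRook.card_image h, if_pos h⟩
  · exact Or.inl (if_neg h)

theorem diagramAlgHom_mem_tensorCentralizer (a : PlanarRookAlgebra n) :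
    diagramAlgHom hq hc a ∈ tensorCentralizer q hq (n + 1) := by
  induction a using MonoidAlgebra.induction_on with
  | of d => rw [diagramAlgHom_of]; exact diagramEnd_mem_tensorCentralizer hq hc d
  | add a b ha hb => rw [map_add]; exact add_mem ha hb
  | smul r a ha => rw [map_smul]; exact Subalgebra.smul_mem _ ha r

/-- Evaluate at `v_{β(d)}`, where `d` has the largest domain in the support. Another diagram of the
support contributes only if its domain contains `β(d)`, hence equals it by maximality; it then has a
different range, so the coefficient of `v_{τ(d)}` is that of `d` alone. -/
theorem diagramAlgHom_injective : Function.Injective (diagramAlgHom (n := n) hq hc) := by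
  rw [injective_iff_map_eq_zero]
  intro a ha
  by_contra hne
  obtain ⟨d, hd, hmax⟩ := Finset.exists_max_image a.coeff.support (fun d => d.dom.card)
    (Finsupp.support_nonempty_iff.2 fun h => hne (MonoidAlgebra.coeff_injective h))
  have hv := Fintype.linearIndependent_iff.1 (linearIndependent_v (n := n) hq)
  have h := LinearMap.congr_fun ha (v q hq d.dom)
  rw [diagramAlgHom, MonoidAlgebra.lift_apply, Finsupp.sum, LinearMap.sum_apply] at h
  -- The indicator sum over `t` lets the coefficient of each `v_t` be collected after exchanging the
  -- sums.
  have hterm : ∀ d' ∈ a.coeff.support, (a.coeff d' • diagramHom hq hc d') (v q hq d.dom) =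
      ∑ t, (if d.dom = d'.dom ∧ d'.image d'.dom = t then a.coeff d' else 0) • v q hq t := by
    intro d' hd'
    change a.coeff d' • diagramEnd hq hc d' (v q hq d.dom) = _
    rw [diagramEnd_v]
    by_cases hs : d.dom ⊆ d'.dom
    · have := Finset.eq_of_subset_of_card_le hs (hmax d' hd')
      simp [this, ite_smul]
    · have : d.dom ≠ d'.dom := fun h => hs h.subset
      simp [this, hs]
  rw [Finset.sum_congr rfl hterm, Finset.sum_comm] at h
  simp only [← Finset.sum_smul, LinearMap.zero_apply] at h
  have h0 := hv _ h (d.image d.dom)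
  rw [Finset.sum_eq_single_of_mem d hd] at h0
  · rw [if_pos ⟨rfl, rfl⟩] at h0
    exact Finsupp.mem_support_iff.1 hd h0
  · intro d' _ hne'
    exact if_neg fun h => hne' (PlanarRook.ext_of_dom_of_image h.1 h.2.symm).symm

/-! ### Matrix units and surjectivity onto the centralizer. -/

/-- The endomorphism `v_s ↦ v_t`, `F v_s ↦ F v_t` that kills `v_r` and `F v_r` for `r ≠ s`. -/
noncomputable def unitEnd (s t : Finset (Fin n)) : Module.End ℂ (⨂[ℂ]^(n + 1) V) :=
  extendEnd hq hc fun r => if r = s then v q hq t else 0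

theorem unitEnd_v (s t r : Finset (Fin n)) :
    unitEnd hq hc s t (v q hq r) = if r = s then v q hq t else 0 :=
  extendEnd_v ..

theorem unitEnd_F_v (s t r : Finset (Fin n)) :
    unitEnd hq hc s t (tensorRep q hq (n + 1) (F q) (v q hq r)) =
      if r = s then tensorRep q hq (n + 1) (F q) (v q hq t) else 0 := by
  rw [unitEnd, extendEnd_F_v, apply_ite (tensorRep q hq (n + 1) (F q)), map_zero]

theorem diagramEnd_eq_sum_unitEnd (d : PlanarRook n) :
    diagramEnd hq hc d = ∑ r ∈ d.dom.powerset, unitEnd hq hc r (d.image r) := by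
  refine end_ext_vFv hq hc (fun s => ?_) fun s => ?_
  · simp [diagramEnd_v, LinearMap.sum_apply, unitEnd_v]
  · simp [diagramEnd_F_v, LinearMap.sum_apply, unitEnd_F_v]

/-- Möbius inversion in recursive form: the diagram `s → t` equals the wanted unit plus units whose
sources are proper subsets of `s`, which lie in the range by induction. -/
theorem unitEnd_mem_range (s t : Finset (Fin n)) (h : s.card = t.card) :
    unitEnd hq hc s t ∈ (diagramAlgHom hq hc).range := by
  induction s using Finset.strongInduction generalizing t with
  | H s ih =>
    have hd := diagramEnd_eq_sum_unitEnd hq hc (PlanarRook.ofCardEq h)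
    rw [PlanarRook.dom_ofCardEq, ← Finset.sum_erase_add _ _ (Finset.mem_powerset_self s),
      PlanarRook.image_ofCardEq] at hd
    rw [eq_sub_of_add_eq' (G := Module.End ℂ (⨂[ℂ]^(n + 1) V)) hd.symm,
      sub_eq_add_neg, ← neg_one_smul ℂ]
    refine add_mem ⟨_, diagramAlgHom_of hq hc _⟩
      (Subalgebra.smul_mem _ (sum_mem fun r hr => ?_) _)
    rw [Finset.mem_erase, Finset.mem_powerset] at hr
    exact ih r (hr.2.ssubset_of_ne hr.1) _
      (PlanarRook.card_image (by rw [PlanarRook.dom_ofCardEq]; exact hr.2)).symm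

/-- Commuting with `E` removes the `F v_t` components of `T v_s`; commuting with `q^{h₁}` leaves
only those `t` with the size of `s`. -/
theorem tensorCentralizer_apply_v (hc : quantumInt q (n + 1) ≠ 0)
    (hq' : ∀ m : ℕ, 0 < m → (q : ℂ) ^ m ≠ 1)
    {T : Module.End ℂ (⨂[ℂ]^(n + 1) V)} (hT : T ∈ tensorCentralizer q hq (n + 1))
    (s : Finset (Fin n)) : ∃ a : Finset (Fin n) → ℂ, (∀ t, a t ≠ 0 → s.card = t.card) ∧
      T (v q hq s) = ∑ t, a t • v q hq t := by
  have hcomm : ∀ g w, T (tensorRep q hq (n + 1) g w) = tensorRep q hq (n + 1) g (T w) :=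
    fun g w => (LinearMap.congr_fun ((Subalgebra.mem_centralizer_iff ℂ).1 hT _ ⟨g, rfl⟩) w).symm
  have hv := Fintype.linearIndependent_iff.1 (linearIndependent_v (n := n) hq)
  have hsum := (basisVFV hq hc).sum_repr (T (v q hq s))
  rw [Fintype.sum_sum_type] at hsum
  simp only [basisVFV_inl, basisVFV_inr] at hsum
  set a := fun t => (basisVFV hq hc).repr (T (v q hq s)) (Sum.inl t)
  set b := fun t => (basisVFV hq hc).repr (T (v q hq s)) (Sum.inr t)
  change ∑ t, a t • _ + ∑ t, b t • _ = _ at hsum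
  have hb : ∀ t, b t = 0 := by
    intro t
    have h := congrArg (tensorRep q hq (n + 1) (E q)) hsum
    rw [← hcomm, tensorRep_E_v, map_zero] at h
    simp only [map_add, map_sum, map_smul, tensorRep_E_v, smul_zero, Finset.sum_const_zero,
      zero_add, tensorRep_E_F_v, ← mul_smul] at h
    exact (mul_eq_zero.1 (hv _ h t)).resolve_right hc
  simp only [hb, zero_smul, Finset.sum_const_zero, add_zero] at hsum
  refine ⟨a, fun t hat => ?_, hsum.symm⟩
  -- The exponent counts factors `x`: `r.card` of them in `u_r` and one more created by `E`.
  have hw : ∀ r : Finset (Fin n), tensorRep q hq (n + 1) (qpow q (1, 0)) (v q hq r) =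
      (q : ℂ) ^ (r.card + 1) • v q hq r := by
    intro r
    rw [tensorRep_qpow_v]
    congr 1
    simp [pow_succ, mul_comm]
  have h := hcomm (qpow q (1, 0)) (v q hq s)
  rw [hw, map_smul, ← hsum, map_sum, Finset.smul_sum, ← sub_eq_zero, ← Finset.sum_sub_distrib] at h
  simp only [map_smul, hw, ← mul_smul, ← sub_smul] at h
  have h0 := hv _ h t
  rw [mul_comm, ← mul_sub] at h0
  have h1 := sub_eq_zero.1 ((mul_eq_zero.1 h0).resolve_left hat)
  by_contra hne
  have key : ∀ i j : ℕ, i < j → (q : ℂ) ^ i ≠ (q : ℂ) ^ j := by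
    intro i j hij h
    refine hq' (j - i) (by omega) (mul_left_cancel₀ (pow_ne_zero i q.ne_zero) ?_)
    rw [← pow_add, mul_one, h]
    congr 1
    omega
  rcases lt_or_gt_of_ne hne with hlt | hlt
  · exact key _ _ (Nat.succ_lt_succ hlt) h1
  · exact key _ _ (Nat.succ_lt_succ hlt) h1.symm

/-- As `T` commutes with `F`, its matrix on the `v_s` determines it and expands it in the `unitEnd s
t`; nonzero entries occur only for sets of equal size. -/
theorem tensorCentralizer_le_range (hq' : ∀ m : ℕ, 0 < m → (q : ℂ) ^ m ≠ 1) :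
    tensorCentralizer q hq (n + 1) ≤ (diagramAlgHom hq hc).range := by
  intro T hT
  choose a ha hTa using tensorCentralizer_apply_v hq hc hq' hT
  have hTF : ∀ w, T (tensorRep q hq (n + 1) (F q) w) = tensorRep q hq (n + 1) (F q) (T w) :=
    fun w => (LinearMap.congr_fun ((Subalgebra.mem_centralizer_iff ℂ).1 hT _ ⟨F q, rfl⟩) w).symm
  have h : T = ∑ s, ∑ t, a s t • unitEnd hq hc s t := by
    refine end_ext_vFv hq hc (fun s => ?_) fun s => ?_
    · rw [hTa, Finset.sum_comm]
      simp [LinearMap.sum_apply, unitEnd_v]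
    · rw [hTF, hTa, Finset.sum_comm]
      simp [LinearMap.sum_apply, unitEnd_F_v]
  rw [h]
  refine sum_mem fun s _ => sum_mem fun t _ => ?_
  by_cases h0 : a s t = 0
  · rw [h0, zero_smul]
    exact zero_mem _
  · exact Subalgebra.smul_mem _ (unitEnd_mem_range hq hc s t (ha s t h0)) _

end QuantumGL11

/-- Here `n` is `k - 1`, and `hq 2 two_pos` gives `q ^ 2 ≠ 1`, which makes `q - q⁻¹` invertible in
the definition of the natural module. -/
theorem mainTheorem3 (n : ℕ) (q : ℂˣ) (hq : ∀ m : ℕ, 0 < m → (q : ℂ) ^ m ≠ 1) :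
    ∃ Φ : PlanarRookAlgebra n ≃ₐ[ℂ]
        QuantumGL11.tensorCentralizer q (hq 2 two_pos) (n + 1),
      QuantumGL11.IsDiagramAction q (hq 2 two_pos)
          ((QuantumGL11.tensorCentralizer q (hq 2 two_pos) (n + 1)).val.toLinearMap ∘ₗ
            Φ.toLinearMap) ∧
        ∀ Ψ : PlanarRookAlgebra n →ₗ[ℂ] Module.End ℂ (⨂[ℂ]^(n + 1) QuantumGL11.V),
          QuantumGL11.IsDiagramAction q (hq 2 two_pos) Ψ →
            Ψ = (QuantumGL11.tensorCentralizer q (hq 2 two_pos) (n + 1)).val.toLinearMap ∘ₗ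
              Φ.toLinearMap := by
  have hc := QuantumGL11.quantumInt_ne_zero hq n.succ_pos
  let ρ := (QuantumGL11.diagramAlgHom (hq 2 two_pos) hc).codRestrict _
    (QuantumGL11.diagramAlgHom_mem_tensorCentralizer (hq 2 two_pos) hc)
  have hρ : Function.Bijective ρ := by
    refine ⟨fun a b hab => ?_, fun T => ?_⟩
    · exact QuantumGL11.diagramAlgHom_injective (hq 2 two_pos) hc (congrArg Subtype.val hab)
    · obtain ⟨a, ha⟩ := QuantumGL11.tensorCentralizer_le_range (hq 2 two_pos) hc hq T.2
      exact ⟨a, Subtype.ext ha⟩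
  exact ⟨AlgEquiv.ofBijective ρ hρ, QuantumGL11.isDiagramAction_diagramAlgHom (hq 2 two_pos) hc,
    fun Ψ hΨ => hΨ.eq_diagramAlgHom (hq 2 two_pos) hc⟩
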